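/- **Corollary 4.31 (Theorem B).** Let $r, d_1, \dots, d_r \in \mathbb{N}_{>0}$ and let $E \subseteq \prod_{i=1}^r \mathbb{Z}^{d_i} = \mathbb{Z}^{d_1 + \dots + d_r}$ be a Presburger set, that is, a set definable by a first-order formula, with parameters from $\mathbb{Z}$, in the structure $\langle \mathbb{Z}, <, + \rangle$. Then $Zar(E)$ holds, that is: if there is an integer $k > 0$ such that $E$ contains no product $B_1 \times \dots \times B_r$ of sets $B_i \subseteq \mathbb{Z}^{d_i}$ with $|B_1| = \dots = |B_r| = k$, then there is a real number $\alpha > 0$ such that for all finite sets $B_1 \subseteq \mathbb{Z}^{d_1}, \dots, B_r \subseteq \mathbb{Z}^{d_r}$, $$|E \cap (B_1 \times \dots \times B_r)| \le \alpha \sum_{1 \le i_1 < \dots < i_{r-1} \le r} \ \prod_{j=1}^{r-1} |B_{i_j}|.$$ -/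

import Mathlib

open FirstOrder

namespace Zarankiewicz

/-- Function symbols of the language `(<, +)`: one binary symbol `+`. -/
inductive OrdGroupFunc : ℕ → Type
  | add : OrdGroupFunc 2

/-- Relation symbols of the language `(<, +)`: one binary symbol `<`. -/
inductive OrdGroupRel : ℕ → Type
  | lt : OrdGroupRel 2

/-- The first-order language `(<, +)`. -/
def ordGroupLang : Language where
  Functions := OrdGroupFunc
  Relations := OrdGroupRel

/-- The structure `⟨ℤ, <, +⟩`. -/
instance intStructure : ordGroupLang.Structure ℤ where
  funMap
    | .add, v => v 0 + v 1
  RelMap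
    | .lt, v => v 0 < v 1

/-- A relation `E ⊆ ∏ i, ℤ ^ (d i)` is Presburger if it is definable, with parameters from `ℤ`, in
`⟨ℤ, <, +⟩`. The product is identified with `ℤ ^ n`, `n = ∑ i, d i`, where the `n` coordinates
are indexed by the pairs (block, position in the block). -/
def IsPresburger {r : ℕ} {d : Fin r → ℕ} (E : Set ((i : Fin r) → (Fin (d i) → ℤ))) : Prop :=
  (Set.univ : Set ℤ).Definable ordGroupLang
    {x : (Σ i : Fin r, Fin (d i)) → ℤ | (fun i j => x ⟨i, j⟩) ∈ E}

section Grids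

variable {r : ℕ} {M : Type*} {d : Fin r → ℕ}

/-- The grid `B 0 × ⋯ × B (r - 1)` in `∏ i, M ^ (d i)` with finite sides `B i ⊆ M ^ (d i)`. -/
def grid (B : (i : Fin r) → Finset (Fin (d i) → M)) : Set ((i : Fin r) → (Fin (d i) → M)) :=
  {x | ∀ i, x i ∈ B i}

/-- `δ(B)`: the sum, over all `i₁ < ⋯ < i_{r-1}` among the `r` indices (that is, over the index sets
of size `r - 1`), of the products `|B i₁| ⋯ |B i_{r-1}|`. -/
def delta (B : (i : Fin r) → Finset (Fin (d i) → M)) : ℕ :=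
  ∑ s ∈ (Finset.univ : Finset (Fin r)).powersetCard (r - 1), ∏ i ∈ s, (B i).card

/-- `E` is `k`-free: it contains no grid all of whose sides have exactly `k` elements. -/
def IsFree (E : Set ((i : Fin r) → (Fin (d i) → M))) (k : ℕ) : Prop :=
  ∀ B : (i : Fin r) → Finset (Fin (d i) → M), (∀ i, (B i).card = k) → ¬ grid B ⊆ E

/-- `E` has linear Zarankiewicz bounds (for the class of all grids). -/
def HasLinearBounds (E : Set ((i : Fin r) → (Fin (d i) → M))) : Prop :=
  ∃ α : ℝ, 0 < α ∧ ∀ B : (i : Fin r) → Finset (Fin (d i) → M),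
    ((E ∩ grid B).ncard : ℝ) ≤ α * (delta B : ℝ)

/-- The Zarankiewicz statement `Zar(E)`: if `E` is `k`-free for some `k > 0`, then `E` has linear
Zarankiewicz bounds. -/
def Zar (E : Set ((i : Fin r) → (Fin (d i) → M))) : Prop :=
  (∃ k : ℕ, 0 < k ∧ IsFree E k) → HasLinearBounds E

end Grids

end Zarankiewicz

/-!
A set definable in `⟨ℤ, <, +⟩` is semilinear, that is, a finite union of linear sets
`L = a + ⟨t⟩` with `⟨t⟩` a finitely generated submonoid: the sets cut out by atomic formulas are
preimages of points and of half-lines of `ℤ` under additive maps, and semilinear sets are closed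
under complement, intersection, preimage and projection. This is
`isSemilinearSet_boundedFormula_realize`.

If `E` is `k`-free, so is each of its linear pieces `L`. Such an `L` has a block `i` such that its
points are determined by their coordinates outside that block. Otherwise for every `i` there are
`p i, q i ∈ ⟨t⟩` differing exactly in block `i`, and the points
`a + ∑ i, (c i • p i + (k - c i) • q i)` with `0 ≤ c i < k` form a grid inside `L` with all sides of
size `k`, because the `i`-th block of such a point depends on `c i` only. This is
`exists_injOn_of_isLinearSet_of_isFree`. Hence forgetting block `i` is injective on `L`, which gives
`|L ∩ grid B| ≤ ∏ j ≠ i, |B j| ≤ δ(B)`, and the number of linear pieces is a suitable constant.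
-/

namespace Zarankiewicz

open Set FirstOrder Language

/-! ### Presburger sets are semilinear -/

section Definability

variable {A : Set ℤ} {α : Type*}

lemma term_realize_eq_add_addMonoidHom (t : ordGroupLang[[A]].Term α) :
    ∃ (k : ℤ) (f : (α → ℤ) →+ ℤ), ∀ v : α → ℤ, t.realize v = k + f v := by
  induction t with simp only [Term.realize]
  | var i => exact ⟨0, Pi.evalAddMonoidHom _ i, by simp⟩
  | @func l f ts ih =>
    cases f with
    | inl f =>
      choose k u ih using ih
      cases f with
      | add =>
        refine ⟨k 0 + k 1, u 0 + u 1, fun v => ?_⟩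
        change (ts 0).realize v + (ts 1).realize v = _
        rw [ih, ih, AddMonoidHom.add_apply]
        ring
    | inr f =>
      cases l with
      | zero =>
        refine ⟨f, 0, fun v => ?_⟩
        rw [AddMonoidHom.zero_apply, add_zero]
        rfl
      | succ => nomatch f

lemma isLinearSet_Ioi_int (c : ℤ) : IsLinearSet (Ioi c) := by
  refine ⟨c + 1, {1}, finite_singleton _, ?_⟩
  ext z
  simp only [mem_Ioi, mem_vadd_set, SetLike.mem_coe, AddSubmonoid.mem_closure_singleton,
    vadd_eq_add]
  constructor
  · intro h
    exact ⟨_, ⟨(z - (c + 1)).toNat, rfl⟩, by simp; lia⟩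
  · rintro ⟨_, ⟨n, rfl⟩, rfl⟩
    simp
    lia

variable [Finite α]

lemma isSemilinearSet_boundedFormula_realize {n : ℕ} (φ : ordGroupLang[[A]].BoundedFormula α n) :
    IsSemilinearSet {v : α ⊕ Fin n → ℤ | φ.Realize (v ∘ Sum.inl) (v ∘ Sum.inr)} := by
  induction φ with simp only [BoundedFormula.Realize]
  | equal t₁ t₂ =>
    rcases term_realize_eq_add_addMonoidHom t₁ with ⟨k₁, u₁, ht₁⟩
    rcases term_realize_eq_add_addMonoidHom t₂ with ⟨k₂, u₂, ht₂⟩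
    convert! isSemilinearSet_setOfPred_eq k₁ k₂ u₁ u₂ using 1
    ext v
    rw [mem_ofPred_eq, ht₁, ht₂, Sum.elim_comp_inl_inr, mem_ofPred_eq]
  | @rel n l R ts =>
    cases R with
    | inl R =>
      cases R with
      | lt =>
        rcases term_realize_eq_add_addMonoidHom (ts 0) with ⟨k₁, u₁, ht₁⟩
        rcases term_realize_eq_add_addMonoidHom (ts 1) with ⟨k₂, u₂, ht₂⟩
        convert! (isLinearSet_Ioi_int (k₁ - k₂)).isSemilinearSet.preimage (u₂ - u₁) using 1
        ext v
        change (ts 0).realize (Sum.elim (v ∘ Sum.inl) (v ∘ Sum.inr)) <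
          (ts 1).realize (Sum.elim (v ∘ Sum.inl) (v ∘ Sum.inr)) ↔ _
        rw [ht₁, ht₂]
        simp only [Sum.elim_comp_inl_inr, mem_preimage, mem_Ioi, AddMonoidHom.sub_apply]
        lia
    | inr R => nomatch R
  | falsum => exact .empty
  | imp _ _ ih₁ ih₂ =>
    convert! (ih₂.compl.inter ih₁).compl using 1
    simp [ofPred_inter_eq_sep, imp_iff_not_or, compl_ofPred]
  | @all n φ ih =>
    -- Regroup the variables so that the quantified one is the right summand, and project it away.
    let e := (Equiv.sumAssoc α (Fin n) (Fin 1)).trans (Equiv.sumCongr (.refl α) finSumFinEquiv)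
    rw [← isSemilinearSet_image_iff (LinearEquiv.funCongrLeft ℤ ℤ e)] at ih
    convert! ih.compl.proj.compl using 1
    simp_rw [compl_ofPred, not_exists, Fin.forall_fin_succ_pi, Fin.forall_fin_zero_pi,
      mem_compl_iff, mem_image, not_not, ← LinearEquiv.eq_symm_apply, LinearEquiv.funCongrLeft_symm,
      exists_eq_right, mem_ofPred, LinearEquiv.funCongrLeft_apply, LinearMap.funLeft,
      LinearMap.coe_mk, AddHom.coe_mk]
    congr! 4
    ext i
    cases i using Fin.lastCases <;> simp [e]

lemma isSemilinearSet_of_definable {s : Set (α → ℤ)} (hs : A.Definable ordGroupLang s) :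
    IsSemilinearSet s := by
  obtain ⟨φ, rfl⟩ := hs
  let e := Equiv.sumEmpty α (Fin 0)
  convert! (isSemilinearSet_boundedFormula_realize φ).image (LinearMap.funLeft ℤ ℤ e.symm)
  ext x
  simp only [mem_ofPred_eq, mem_image]
  rw [(e.arrowCongr (.refl ℤ)).exists_congr_left]
  simp [Formula.Realize, Unique.eq_default, Function.comp_def, LinearMap.funLeft, e]

end Definability

variable {r : ℕ} {d : Fin r → ℕ}

lemma IsPresburger.isSemilinearSet {E : Set ((i : Fin r) → (Fin (d i) → ℤ))}
    (hE : IsPresburger E) : IsSemilinearSet E := by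
  let f : ((Σ i : Fin r, Fin (d i)) → ℤ) →+ ((i : Fin r) → (Fin (d i) → ℤ)) :=
    { toFun x i j := x ⟨i, j⟩
      map_zero' := rfl
      map_add' _ _ := rfl }
  have hf : Function.Surjective f := fun y => ⟨fun p => y p.1 p.2, rfl⟩
  have h : IsSemilinearSet (f ⁻¹' E) := isSemilinearSet_of_definable hE
  simpa only [image_preimage_eq E hf] using h.image f

/-! ### Linear sets without large grids -/

lemma IsFree.mono {M : Type*} {E F : Set ((i : Fin r) → (Fin (d i) → M))} {k : ℕ}
    (hF : IsFree F k) (h : E ⊆ F) : IsFree E k :=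
  fun B hB hBE => hF B hB (hBE.trans h)

/-- A `k`-free linear set has a block that is determined by the other ones. -/
lemma exists_injOn_of_isLinearSet_of_isFree {L : Set ((i : Fin r) → (Fin (d i) → ℤ))} {k : ℕ}
    (hL : IsLinearSet L) (hk : IsFree L k) :
    ∃ i : Fin r, InjOn (fun (x : (i : Fin r) → (Fin (d i) → ℤ)) (j : {j // j ≠ i}) => x j.1) L := by
  obtain ⟨a, t, -, rfl⟩ := hL
  by_contra! h
  simp only [InjOn, mem_vadd_set, SetLike.mem_coe, vadd_eq_add] at h
  push Not at h
  choose x hx y hy hxy hne using h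
  choose p hp hpx using hx
  choose q hq hqy using hy
  -- The points `p i` and `q i` of `⟨t⟩` differ exactly in block `i`.
  have hoff (i j : Fin r) (hj : j ≠ i) : p i j = q i j := by
    have := congrFun (hxy i) ⟨j, hj⟩
    simpa [← hpx, ← hqy] using this
  have hdiag (i : Fin r) : p i i - q i i ≠ 0 := by
    intro h0
    refine hne i ?_
    rw [← hpx, ← hqy]
    congr 1
    funext j
    by_cases hj : j = i
    · subst hj; exact sub_eq_zero.1 h0
    · exact hoff i j hj
  -- `g i c` is the `i`-th block of a grid point with parameter `c` in block `i`, whatever the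
  -- parameters in the other blocks are.
  let g (i : Fin r) (c : ℕ) : Fin (d i) → ℤ :=
    a i + ∑ j, k • q j i + c • (p i i - q i i)
  have hg (i : Fin r) : Function.Injective (g i) := fun c c' hc => by
    obtain ⟨l, hl⟩ := Function.ne_iff.1 (hdiag i)
    have h := congrFun (add_left_cancel hc) l
    simp only [Pi.smul_apply, nsmul_eq_mul] at h
    exact_mod_cast mul_right_cancel₀ hl h
  refine hk (fun i => (Finset.range k).image (g i)) (fun i => ?_) fun z hz => ?_
  · rw [Finset.card_image_of_injective _ (hg i), Finset.card_range]
  · simp only [grid, mem_ofPred_eq, Finset.mem_image, Finset.mem_range] at hz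
    choose c hc hcz using hz
    refine ⟨∑ j, (c j • p j + (k - c j) • q j), ?_, ?_⟩
    · exact sum_mem fun j _ => add_mem (nsmul_mem (hp j) _) (nsmul_mem (hq j) _)
    · funext i
      rw [← hcz i]
      simp only [g, vadd_eq_add, Pi.add_apply, Finset.sum_apply, Pi.smul_apply, add_assoc]
      congr 1
      have hsingle : c i • (p i i - q i i) = ∑ j, c j • (p j i - q j i) := by
        rw [Fintype.sum_eq_single i]
        intro j hj
        rw [hoff j i hj.symm, sub_self, smul_zero]
      rw [hsingle, ← Finset.sum_add_distrib]
      refine Finset.sum_congr rfl fun j _ => ?_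
      obtain ⟨m, hm⟩ := Nat.exists_eq_add_of_lt (hc j)
      rw [show k - c j = m + 1 by lia, hm]
      module

lemma finite_grid {M : Type*} (B : (i : Fin r) → Finset (Fin (d i) → M)) : (grid B).Finite := by
  convert! Set.Finite.pi' fun i => (B i).finite_toSet

/-- If block `i` is determined by the other ones on `L`, then `L` meets a grid `B` in at most
`∏ j ≠ i, |B j|` points, which is one of the summands of `δ(B)`. -/
lemma ncard_inter_grid_le_delta {M : Type*} {L : Set ((i : Fin r) → (Fin (d i) → M))} {i : Fin r}
    (hL : InjOn (fun (x : (i : Fin r) → (Fin (d i) → M)) (j : {j // j ≠ i}) => x j.1) L)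
    (B : (i : Fin r) → Finset (Fin (d i) → M)) : (L ∩ grid B).ncard ≤ delta B := by
  classical
  calc (L ∩ grid B).ncard
      ≤ (Fintype.piFinset fun j : {j // j ≠ i} => B j : Set _).ncard :=
        ncard_le_ncard_of_injOn _
          (fun x hx => by simpa using fun j (_ : j ≠ i) => hx.2 j) (hL.mono inter_subset_left)
          (Finset.finite_toSet _)
    _ = ∏ j ∈ Finset.univ.erase i, (B j).card := by
        rw [ncard_coe_finset, Fintype.card_piFinset]
        exact (Finset.prod_subtype _ (by simp) fun j => (B j).card).symm
    _ ≤ delta B :=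
        Finset.single_le_sum (f := fun s => ∏ j ∈ s, (B j).card) (fun _ _ => Nat.zero_le _)
          (by simp [Finset.mem_powersetCard])

lemma zar_of_isSemilinearSet {E : Set ((i : Fin r) → (Fin (d i) → ℤ))}
    (hE : IsSemilinearSet E) : Zar E := by
  rintro ⟨k, -, hk⟩
  obtain ⟨S, hS, rfl⟩ := isSemilinearSet_iff.1 hE
  -- The summand `1` keeps the constant positive when there are no pieces.
  refine ⟨S.card + 1, by positivity, fun B => ?_⟩
  have hpiece (L) (hLS : L ∈ S) : (L ∩ grid B).ncard ≤ delta B := by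
    obtain ⟨i, hi⟩ := exists_injOn_of_isLinearSet_of_isFree (hS L hLS)
      (hk.mono (subset_sUnion_of_mem hLS))
    exact ncard_inter_grid_le_delta hi B
  have hsum : (⋃₀ (S : Set (Set _)) ∩ grid B).ncard ≤ S.card * delta B := by
    rw [sUnion_eq_biUnion, iUnion₂_inter]
    calc _ ≤ ∑ L ∈ S, (L ∩ grid B).ncard := Finset.set_ncard_biUnion_le S fun L => L ∩ grid B
      _ ≤ S.card * delta B := by simpa using Finset.sum_le_card_nsmul S _ _ hpiece
  calc ((⋃₀ (S : Set (Set _)) ∩ grid B).ncard : ℝ) ≤ S.card * delta B := mod_cast hsum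
    _ ≤ (S.card + 1) * delta B := by gcongr; simp

end Zarankiewicz

theorem corollary4p31 {r : ℕ} (hr : 0 < r) {d : Fin r → ℕ} (hd : ∀ i, 0 < d i)
    (E : Set ((i : Fin r) → (Fin (d i) → ℤ))) (hE : Zarankiewicz.IsPresburger E) :
    Zarankiewicz.Zar E :=
  Zarankiewicz.zar_of_isSemilinearSet hE.isSemilinearSet
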